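/- Conventions. Let $\sigma$ be a relational vocabulary (a set of relation symbols, each of positive finite arity) and let $k\ge 1$. A $\sigma$-structure $A$ is a (possibly empty) set $A$ with a relation $R^A\subseteq A^n$ for every $n$-ary $R\in\sigma$; homomorphisms preserve these relations. *The pebbling comonad.* The universe of $\mathbb P_kA$ is the set of finite non-empty sequences $s=[(p_1,a_1),\dots,(p_n,a_n)]$ with $p_i\in\{1,\dots,k\}$ and $a_i\in A$. Write $\sqsubseteq$ for the prefix order and $\varepsilon_A(s)=a_n$. Call $s$ active in $t$ if $s\sqsubseteq t$ and the pebble $p_n$ of the last move of $s$ does not occur in the suffix of $s$ in $t$. Then $R^{\mathbb P_kA}(s_1,\dots,s_m)$ holds iff the $s_i$ are pairwise comparable for $\sqsubseteq$, $s_i$ is active in $s_j$ whenever $s_i\sqsubseteq s_j$, and $R^A(\varepsilon_A(s_1),\dots,\varepsilon_A(s_m))$. For a function $f:\mathbb P_kA\to B$ put $f^*[(p_1,a_1),\dots,(p_n,a_n)]=[(p_1,b_1),\dots,(p_n,b_n)]$ with $b_i=f[(p_1,a_1),\dots,(p_i,a_i)]$. A morphism $A\to B$ of the coKleisli category $\mathrm{Kl}(\mathbb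 P_k)$ is a homomorphism $f:\mathbb P_kA\to B$; composition is $g\bullet f=g\circ f^*$ and the identity of $A$ is $\varepsilon_A$. It is an $I$-morphism if $f(s)=f(t)$ whenever $s$ is active in $t$ and $\varepsilon_A(s)=\varepsilon_A(t)$. *Equivalences of structures.* $A\rightleftarrows_k B$ means that there are homomorphisms $\mathbb P_kA\to B$ and $\mathbb P_kB\to A$. $A\cong_{\mathrm{Kl}(\mathbb P_k)}B$ means that $A$ and $B$ are isomorphic in $\mathrm{Kl}(\mathbb P_k)$, and $A\cong_k B$ that there are $I$-morphisms $f:\mathbb P_kA\to B$ and $g:\mathbb P_kB\to A$ that are inverse to each other in $\mathrm{Kl}(\mathbb P_k)$. Let $W_{A,B}$ be the set of pairs $(s,t)\in\mathbb P_kA\times\mathbb P_kB$ with the same sequence of pebbles for which $\{(a_p,b_p): p \text{ occurs in } s\}$ is a partial isomorphism from $A$ to $B$, where $a_p$, $b_p$ are the elements at the last occurrence of $p$ in $s$ and in $t$. Let $S(A,B)$ be the set of functions $f:\mathbb P_kA\to B$ with $(s,f^*(s))\in W_{A,B}$ for all $s$. $A\leftrightarrow_k B$ means that there are non-empty sets $F\subseteq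 S(A,B)$, $G\subseteq S(B,A)$ such that for all $f\in F$, $s\in\mathbb P_kA$ there is $g\in G$ with $g^*f^*(s)=s$, and for all $g\in G$, $t\in\mathbb P_kB$ there is $f\in F$ with $f^*g^*(t)=t$. *Logics.* $\mathcal L^k$ is the fragment of the infinitary logic $\mathcal L_{\infty,\omega}$ with equality (arbitrary set-indexed conjunctions and disjunctions) of the formulas that use only $k$ variables, free or bound. $\exists\mathcal L^k$ consists of its formulas built from atomic formulas by conjunction, disjunction and existential quantification. $\mathcal L^k(\#)$ extends $\mathcal L^k$ by the counting quantifiers $\exists_{\ge n}x$ and $\exists_{\le n}x$, $n\in\mathbb N$. For a logic $\mathcal L$, $A\equiv^{\mathcal L}B$ means that $A$ and $B$ satisfy the same sentences of $\mathcal L$. **Theorem.** 1. For all structures $A,B$: $A\equiv^{\exists\mathcal L^k}B\iff A\rightleftarrows_k B$. 2. For all finite structures $A,B$: $A\equiv^{\mathcal L^k}B\iff A\leftrightarrow_k B$. 3. For all finite structures $A,B$: $A\equiv^{\mathcal L^k(\#)}B\iff A\cong_k B$, and also $A\equiv^{\mathcal L^k(\#)}B\iff A\cong_{\mathrm{Kl}(\mathbb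 P_k)}B$. -/

import Mathlib

open scoped FirstOrder

universe u v w

namespace Pebbling

section Comonad

variable {k : ℕ} {A B C : Type w}

/-- Finite non-empty sequences of moves `(p, a)`, with `p` one of `k` pebbles and `a ∈ A`: the
universe of `ℙ_k A`. -/
@[ext]
structure Play (k : ℕ) (A : Type w) : Type w where
  moves : List (Fin k × A)
  ne_nil : moves ≠ []

/-- The last move of a play. -/
def Play.last (s : Play k A) : Fin k × A := s.moves.getLast s.ne_nil

/-- The counit `ε`: the element chosen in the last move. -/
def Play.eps (s : Play k A) : A := s.last.2

/-- The prefix of a play that ends with the move number `i` (counted from `0`). -/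
def Play.upTo (s : Play k A) (i : Fin s.moves.length) : Play k A :=
  ⟨s.moves.take (i + 1), by
    have h := s.ne_nil
    simpa [List.take_eq_nil_iff] using h⟩

/-- The pebble of the last move of `s` does not appear in the suffix of `s` in `t`
(no condition if `s` is not a prefix of `t`). -/
def Play.ActiveIn (s t : Play k A) : Prop :=
  ∀ r : List (Fin k × A), t.moves = s.moves ++ r → ∀ m ∈ r, m.1 ≠ s.last.1

/-- The coextension `f*` of a function `f : ℙ_k A → B`: it sends `[(p₁, a₁), …, (p_n, a_n)]` to
`[(p₁, b₁), …, (p_n, b_n)]` with `b_i = f [(p₁, a₁), …, (p_i, a_i)]`. -/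
def coext (f : Play k A → B) (s : Play k A) : Play k B :=
  ⟨List.ofFn fun i : Fin s.moves.length => ((s.moves.get i).1, f (s.upTo i)), by
    have h := s.ne_nil
    simpa [List.ofFn_eq_nil_iff] using h⟩

theorem coext_length (f : Play k A → B) (s : Play k A) :
    (coext f s).moves.length = s.moves.length := by
  simp [coext]

theorem coext_getElem (f : Play k A → B) (s : Play k A) (i : ℕ) (h : i < s.moves.length) :
    (coext f s).moves[i]'(by rw [coext_length]; exact h) = ((s.moves[i]).1, f (s.upTo ⟨i, h⟩)) := by
  simp [coext]

theorem upTo_upTo (s : Play k A) (i j : ℕ) (h : i < s.moves.length) (hj : j < (s.upTo ⟨i, h⟩).moves.length)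
    (hj' : j < s.moves.length) : (s.upTo ⟨i, h⟩).upTo ⟨j, hj⟩ = s.upTo ⟨j, hj'⟩ := by
  apply Play.ext
  simp only [Play.upTo, List.length_take] at hj ⊢
  rw [List.take_take]
  congr 1
  omega

theorem upTo_last (s : Play k A) (i : ℕ) (h : i < s.moves.length) : (s.upTo ⟨i, h⟩).last = s.moves[i] := by
  simp only [Play.last, Play.upTo]
  rw [List.getLast_eq_getElem]
  simp only [List.length_take, List.getElem_take]
  congr 1
  omega

theorem upTo_self (s : Play k A) (i : ℕ) (h : i < s.moves.length) (hi : i + 1 = s.moves.length) :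
    s.upTo ⟨i, h⟩ = s := by
  apply Play.ext
  simp [Play.upTo, hi]

theorem coext_last (f : Play k A → B) (s : Play k A) :
    (coext f s).last = (s.last.1, f s) := by
  have hs : 0 < s.moves.length := List.length_pos_iff.2 s.ne_nil
  have h1 : (coext f s).last = (coext f s).moves[s.moves.length - 1]'(by rw [coext_length]; omega) := by
    simp only [Play.last]
    rw [List.getLast_eq_getElem]
    simp only [coext_length]
  rw [h1, coext_getElem f s _ (by omega), upTo_self s _ _ (by omega)]
  simp only [Play.last]
  rw [List.getLast_eq_getElem]

theorem coext_upTo (f : Play k A → B) (s : Play k A) (i : ℕ) (h : i < s.moves.length) :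
    coext f (s.upTo ⟨i, h⟩) = (coext f s).upTo ⟨i, by rw [coext_length]; exact h⟩ := by
  apply Play.ext
  apply List.ext_getElem
  · simp [Play.upTo, coext_length]
  · intro j h1 h2
    have hj : j < (s.upTo ⟨i, h⟩).moves.length := by rwa [coext_length] at h1
    have hj' : j < s.moves.length := by
      simp only [Play.upTo, List.length_take] at hj
      omega
    rw [coext_getElem f _ j hj, upTo_upTo s i j h hj hj']
    simp only [Play.upTo, List.getElem_take]
    rw [coext_getElem f s j hj']
    simp only [Play.upTo]

theorem coext_append {f : Play k A → B} {s t : Play k A} {r : List (Fin k × A)}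
    (h : t.moves = s.moves ++ r) :
    ∃ r' : List (Fin k × B), (coext f t).moves = (coext f s).moves ++ r' ∧
      r'.map Prod.fst = r.map Prod.fst := by
  have hs : 0 < s.moves.length := List.length_pos_iff.2 s.ne_nil
  have hl : t.moves.length = s.moves.length + r.length := by rw [h, List.length_append]
  have hst : s = t.upTo ⟨s.moves.length - 1, by omega⟩ := by
    apply Play.ext
    simp only [Play.upTo]
    rw [h, Nat.sub_add_cancel hs, List.take_left]
  refine ⟨(coext f t).moves.drop s.moves.length, ?_, ?_⟩
  · have h2 : (coext f s).moves = (coext f t).moves.take s.moves.length := by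
      have h3 := congrArg (fun x : Play k A => (coext f x).moves) hst
      rw [h3, coext_upTo]
      simp only [Play.upTo]
      rw [Nat.sub_add_cancel hs]
    rw [h2, List.take_append_drop]
  · apply List.ext_getElem
    · simp [coext_length, hl]
    · intro j h1 h2
      have hj : j < r.length := by simpa using h2
      simp only [List.getElem_map, List.getElem_drop]
      rw [coext_getElem f t _ (by omega)]
      rw [List.getElem_of_eq h, List.getElem_append_right (by omega)]
      simp

/-- First law of a comonad in Kleisli form: `ε* = id`. -/
theorem coext_eps (s : Play k A) : coext Play.eps s = s := by
  apply Play.ext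
  apply List.ext_getElem
  · exact coext_length _ _
  · intro j h1 h2
    rw [coext_getElem _ s j h2, Play.eps, upTo_last]

/-- Second law: `ε ∘ f* = f`. -/
theorem eps_coext (f : Play k A → B) (s : Play k A) : (coext f s).eps = f s := by
  rw [Play.eps, coext_last]

/-- Third law: `(g ∘ f*)* = g* ∘ f*`. -/
theorem coext_coext (f : Play k A → B) (g : Play k B → C) (s : Play k A) :
    coext (fun x => g (coext f x)) s = coext g (coext f s) := by
  apply Play.ext
  apply List.ext_getElem
  · simp [coext_length]
  · intro j h1 h2
    have hj : j < s.moves.length := by rwa [coext_length] at h1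
    rw [coext_getElem _ s j hj, coext_getElem g _ j (by rwa [coext_length]),
      coext_getElem f s j hj, coext_upTo]

end Comonad

section Structures

variable (L : FirstOrder.Language.{u, v}) [L.IsRelational] (k : ℕ)

/-- The structure `ℙ_k A`. -/
instance playStructure (A : Type w) [L.Structure A] : L.Structure (Play k A) where
  funMap f _ := isEmptyElim f
  RelMap R s :=
    (∀ i j, (s i).moves <+: (s j).moves ∨ (s j).moves <+: (s i).moves) ∧
    (∀ i j, (s i).ActiveIn (s j)) ∧
    FirstOrder.Language.Structure.RelMap R (fun i => (s i).eps)

variable {A B C : Type w} [L.Structure A] [L.Structure B] [L.Structure C]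

/-- The counit as a homomorphism: the identity of `A` in the coKleisli category. -/
def counit (A : Type w) [L.Structure A] : Play k A →[L] A where
  toFun := Play.eps
  map_fun' f _ := isEmptyElim f
  map_rel' _ _ h := h.2.2

variable {L k}

/-- The coextension of a homomorphism is a homomorphism. -/
def coextHom (f : Play k A →[L] B) : Play k A →[L] Play k B where
  toFun := coext f
  map_fun' g _ := isEmptyElim g
  map_rel' R s h := by
    have key : ∀ i j, (s i).moves <+: (s j).moves → (coext f (s i)).moves <+: (coext f (s j)).moves := by
      rintro i j ⟨r, hr⟩
      obtain ⟨r', h1, -⟩ := coext_append (f := f) hr.symm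
      exact ⟨r', h1.symm⟩
    refine ⟨fun i j => (h.1 i j).imp (key i j) (key j i), fun i j r hr m hm => ?_, ?_⟩
    · have hpre : (s i).moves <+: (s j).moves := by
        rcases h.1 i j with h1 | h1
        · exact h1
        · have h2 := h1.length_le
          have h3 := congrArg List.length hr
          simp only [Function.comp_apply, List.length_append, coext_length] at h3
          rw [List.IsPrefix.eq_of_length h1 (by omega)]
      obtain ⟨q, hq⟩ := hpre
      obtain ⟨r', h4, h5⟩ := coext_append (f := f) hq.symm
      have hrr : r = r' := List.append_cancel_left (hr.symm.trans h4)
      subst hrr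
      have h6 : m.1 ∈ q.map Prod.fst := h5 ▸ List.mem_map_of_mem hm
      obtain ⟨m', hm', h7⟩ := List.mem_map.1 h6
      have h8 := h.2.1 i j q hq.symm m' hm'
      simp only [Function.comp_apply, coext_last]
      rw [← h7]
      exact h8
    · have h9 := f.map_rel R s h
      simpa only [Function.comp_def, eps_coext] using h9

/-- CoKleisli composition `g • f = g ∘ f*`. -/
def klComp (g : Play k B →[L] C) (f : Play k A →[L] B) : Play k A →[L] C :=
  g.comp (coextHom f)

/-- `f` and `g` are inverses of each other in the coKleisli category. -/
def KlInverse (f : Play k A →[L] B) (g : Play k B →[L] A) : Prop :=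
  klComp g f = counit L k A ∧ klComp f g = counit L k B

/-- `f` preserves equality between active positions, that is, `f` also preserves a binary relation
symbol that is interpreted as the identity relation on `A` and on `B`. -/
def IsIMorphism (f : Play k A →[L] B) : Prop :=
  ∀ s t : Play k A, s.moves <+: t.moves → s.ActiveIn t → s.eps = t.eps → f s = f t

variable (L k A B)

/-- There are coKleisli morphisms in both directions. -/
def KlMorphismsBothWays : Prop :=
  Nonempty (Play k A →[L] B) ∧ Nonempty (Play k B →[L] A)

/-- `A` and `B` are isomorphic in the coKleisli category. -/
def KlIso : Prop :=
  ∃ (f : Play k A →[L] B) (g : Play k B →[L] A), KlInverse f g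

/-- `A` and `B` are isomorphic in the coKleisli category through `I`-morphisms. -/
def KlIIso : Prop :=
  ∃ (f : Play k A →[L] B) (g : Play k B →[L] A),
    IsIMorphism f ∧ IsIMorphism g ∧ KlInverse f g

variable {k A B}

/-- The last occurrence of the pebble `p` in the play `s` is on the element `a`. -/
def Play.LastOn (s : Play k A) (p : Fin k) (a : A) : Prop :=
  ∃ q r : List (Fin k × A), s.moves = q ++ (p, a) :: r ∧ ∀ m ∈ r, m.1 ≠ p

/-- The relation `φ_{s,t}`: all pairs of elements that carry the same pebble at the end of the plays
`s` and `t`. -/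
def pebbledPairs (s : Play k A) (t : Play k B) : Set (A × B) :=
  {x | ∃ p : Fin k, s.LastOn p x.1 ∧ t.LastOn p x.2}

/-- The relation `φ` is a partial isomorphism between `A` and `B`. -/
def IsPartialIso (φ : Set (A × B)) : Prop :=
  (∀ x ∈ φ, ∀ y ∈ φ, x.1 = y.1 ↔ x.2 = y.2) ∧
  ∀ (n : ℕ) (R : L.Relations n) (x : Fin n → A × B), (∀ i, x i ∈ φ) →
    (FirstOrder.Language.Structure.RelMap R (fun i => (x i).1) ↔ FirstOrder.Language.Structure.RelMap R (fun i => (x i).2))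

variable (k A B)

/-- The winning positions `W_{A,B}`. -/
def winning : Set (Play k A × Play k B) :=
  {x | x.1.moves.map Prod.fst = x.2.moves.map Prod.fst ∧ IsPartialIso L (pebbledPairs x.1 x.2)}

/-- The set `S(A,B)` of all functions `f : ℙ_k A → B` such that `(s, f* s)` is always winning. -/
def strategies : Set (Play k A → B) :=
  {f | ∀ s, (s, coext f s) ∈ winning L k A B}

/-- The back-and-forth equivalence: there is a locally invertible pair `(F, G)` of non-empty sets. -/
def BackAndForth : Prop :=
  ∃ (F : Set (Play k A → B)) (G : Set (Play k B → A)),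
    F.Nonempty ∧ G.Nonempty ∧ F ⊆ strategies L k A B ∧ G ⊆ strategies L k B A ∧
    (∀ f ∈ F, ∀ s : Play k A, ∃ g ∈ G, coext g (coext f s) = s) ∧
    (∀ g ∈ G, ∀ t : Play k B, ∃ f ∈ F, coext f (coext g t) = t)

end Structures

/-! ### Infinitary logic with `k` variables -/

/-- Formulas of infinitary logic with equality and counting quantifiers, over the variables
`x_i`, `i : Fin k`. A variable may be quantified repeatedly. -/
inductive InfFormula (L : FirstOrder.Language.{u, v}) (k : ℕ) : Type (max u v (w + 1))
  | rel {n : ℕ} (R : L.Relations n) (x : Fin n → Fin k) : InfFormula L k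
  | equal (i j : Fin k) : InfFormula L k
  | neg (φ : InfFormula L k) : InfFormula L k
  | conj {ι : Type w} (φ : ι → InfFormula L k) : InfFormula L k
  | disj {ι : Type w} (φ : ι → InfFormula L k) : InfFormula L k
  | ex (i : Fin k) (φ : InfFormula L k) : InfFormula L k
  | all (i : Fin k) (φ : InfFormula L k) : InfFormula L k
  | exGe (n : ℕ) (i : Fin k) (φ : InfFormula L k) : InfFormula L k
  | exLe (n : ℕ) (i : Fin k) (φ : InfFormula L k) : InfFormula L k

namespace InfFormula

variable {L : FirstOrder.Language.{u, v}} {k : ℕ}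

/-- The free variables of a formula. -/
def freeVars : InfFormula.{u, v, w} L k → Set (Fin k)
  | rel _ x => Set.range x
  | equal i j => {i, j}
  | neg φ => φ.freeVars
  | conj φ => ⋃ c, (φ c).freeVars
  | disj φ => ⋃ c, (φ c).freeVars
  | ex i φ => φ.freeVars \ {i}
  | all i φ => φ.freeVars \ {i}
  | exGe _ i φ => φ.freeVars \ {i}
  | exLe _ i φ => φ.freeVars \ {i}

/-- The formula contains no counting quantifier: the fragment `𝓛^k`. -/
def CountingFree : InfFormula.{u, v, w} L k → Prop
  | rel _ _ => True
  | equal _ _ => True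
  | neg φ => φ.CountingFree
  | conj φ => ∀ c, (φ c).CountingFree
  | disj φ => ∀ c, (φ c).CountingFree
  | ex _ φ => φ.CountingFree
  | all _ φ => φ.CountingFree
  | exGe _ _ _ => False
  | exLe _ _ _ => False

/-- The formula is built from atomic formulas by conjunctions, disjunctions and existential
quantifiers only: the fragment `∃𝓛^k`. -/
def ExistentialPositive : InfFormula.{u, v, w} L k → Prop
  | rel _ _ => True
  | equal _ _ => True
  | neg _ => False
  | conj φ => ∀ c, (φ c).ExistentialPositive
  | disj φ => ∀ c, (φ c).ExistentialPositive
  | ex _ φ => φ.ExistentialPositive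
  | all _ _ => False
  | exGe _ _ _ => False
  | exLe _ _ _ => False

/-- Satisfaction under a partial assignment. It is the usual satisfaction relation whenever the
assignment is defined on all free variables of the formula; partial assignments are used so that
sentences can be evaluated in the empty structure too. -/
def Realize {A : Type w} [L.Structure A] :
    InfFormula.{u, v, w} L k → (Fin k → Option A) → Prop
  | rel R x, e => ∃ a, (∀ i, e (x i) = some (a i)) ∧ FirstOrder.Language.Structure.RelMap R a
  | equal i j, e => ∃ a, e i = some a ∧ e j = some a
  | neg φ, e => ¬ φ.Realize e
  | conj φ, e => ∀ c, (φ c).Realize e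
  | disj φ, e => ∃ c, (φ c).Realize e
  | ex i φ, e => ∃ a, φ.Realize (Function.update e i (some a))
  | all i φ, e => ∀ a, φ.Realize (Function.update e i (some a))
  | exGe n i φ, e => (n : ℕ∞) ≤ {a | φ.Realize (Function.update e i (some a))}.encard
  | exLe n i φ, e => {a | φ.Realize (Function.update e i (some a))}.encard ≤ (n : ℕ∞)

/-- A formula without free variables. -/
def IsSentence (φ : InfFormula.{u, v, w} L k) : Prop := φ.freeVars = ∅

/-- Truth of a sentence in a structure. -/
def Holds (φ : InfFormula.{u, v, w} L k) (A : Type w) [L.Structure A] : Prop :=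
  φ.Realize (fun _ => (none : Option A))

end InfFormula

section Equivalences

variable (L : FirstOrder.Language.{u, v}) (k : ℕ) (A B : Type w) [L.Structure A] [L.Structure B]

/-- Equivalence for the existential positive `k`-variable logic `∃𝓛^k`. -/
def ExPosEquiv : Prop :=
  ∀ φ : InfFormula.{u, v, w} L k, φ.IsSentence → φ.ExistentialPositive →
    (φ.Holds A ↔ φ.Holds B)

/-- Equivalence for the `k`-variable logic `𝓛^k`. -/
def VarEquiv : Prop :=
  ∀ φ : InfFormula.{u, v, w} L k, φ.IsSentence → φ.CountingFree → (φ.Holds A ↔ φ.Holds B)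

/-- Equivalence for the `k`-variable logic with counting quantifiers `𝓛^k(#)`. -/
def CountingEquiv : Prop :=
  ∀ φ : InfFormula.{u, v, w} L k, φ.IsSentence → (φ.Holds A ↔ φ.Holds B)

end Equivalences

end Pebbling

/-!
All three equivalences are proved through pebble games. A function `f : ℙ_k A → B` is a strategy
that answers moves in `A` by moves in `B`, and its coextension `f*` records the resulting play. Only
the position reached matters for the logic: the partial assignment that sends each pebble, that is
each variable, to the element on which it was last put (`position`). A strategy is a homomorphism
exactly if it preserves the relations at all positions (`preservesRel_imp_relMap`,
`preservesRel_coextList`).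

From logic to strategies, one plays so that the formulas of the fragment that hold on the left also
hold on the right (`Transfers`). Every move has a good answer, since otherwise a conjunction over
all answers, behind a quantifier, would separate the positions (`Transfers.forth`). With counting
quantifiers over finite structures, the answers to the moves of a pebble even form a bijection
(`Transfers.exists_equiv`). Strategies are assembled from the answers by recursion on the play
(`exists_strategy`, `exists_strategy_inverting`, `exists_inverse_strategies`). They are
`I`-morphisms when equality of variables is a formula of the fragment.

From strategies to logic, one shows by induction on formulas that the positions reached satisfy
corresponding formulas. The difficulty is that homomorphisms on plays need not respect equality of
pebbled elements. In the existential positive case, the logical game is played on positions in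
which pebbles on equal elements are renamings of one pebble of the game of `f`; this is possible
because a pebble that is picked up leaves one pebble free (`realize_of_hom`). In the counting case,
consider equivalence of positions in the bijective game that ignores equality
(`BijectivelyEquiv`). It is transitive and stable under renaming pebbles. Stability shows that
putting a pebble on an element already pebbled may be answered by the corresponding pebbled
element, and transitivity allows a bijection of answers to be changed by transpositions until it
does this for all pebbled elements (`exists_equiv_extending`). Such bijections respect equality
(`BijectivelyEquiv.realize_iff`).
-/

namespace Pebbling

/-! ### Positions and strategies on lists of moves -/

section Lists

variable {k : ℕ} {A B : Type w}

/-- The placement of the pebbles after the moves `l`: the element, if any, on which each pebble has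
last been put. -/
def position (l : List (Fin k × A)) : Fin k → Option A :=
  l.foldl (fun e m => Function.update e m.1 (some m.2)) fun _ => none

@[simp]
theorem position_nil : position ([] : List (Fin k × A)) = fun _ => none := rfl

@[simp]
theorem position_concat (l : List (Fin k × A)) (m : Fin k × A) :
    position (l ++ [m]) = Function.update (position l) m.1 (some m.2) := by
  simp [position, List.foldl_append]

theorem position_append_of_forall_ne {l r : List (Fin k × A)} {p : Fin k}
    (h : ∀ m ∈ r, m.1 ≠ p) : position (l ++ r) p = position l p := by
  induction r using List.reverseRecOn with
  | nil => simp
  | append_singleton r m ih =>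
    rw [← List.append_assoc, position_concat, Function.update_of_ne (h m (by simp)).symm,
      ih fun m' hm' => h m' (by simp [hm'])]

theorem position_eq_some_iff {l : List (Fin k × A)} {p : Fin k} {a : A} :
    position l p = some a ↔ ∃ q r, l = q ++ (p, a) :: r ∧ ∀ m ∈ r, m.1 ≠ p := by
  constructor
  · intro h
    induction l using List.reverseRecOn with
    | nil => simp at h
    | append_singleton l m ih =>
      rw [position_concat] at h
      by_cases hp : p = m.1
      · subst hp
        rw [Function.update_self, Option.some.injEq] at h
        exact ⟨l, [], by simp [← h], by simp⟩
      · rw [Function.update_of_ne hp] at h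
        obtain ⟨q, r, rfl, hr⟩ := ih h
        refine ⟨q, r ++ [m], by simp, fun m' hm' => ?_⟩
        rcases List.mem_append.1 hm' with h' | h'
        · exact hr m' h'
        · rw [List.mem_singleton.1 h']
          exact Ne.symm hp
  · rintro ⟨q, r, rfl, hr⟩
    rw [List.append_cons, position_append_of_forall_ne hr, position_concat, Function.update_self]

theorem Play.moves_eq (s : Play k A) : s.moves = s.moves.dropLast ++ [s.last] :=
  (List.dropLast_append_getLast s.ne_nil).symm

/-- A pebble that has not moved since the end of the play `s` still lies on the last element
of `s`. -/
theorem position_of_active {l r : List (Fin k × A)} {s : Play k A} (h : l = s.moves ++ r)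
    (hr : ∀ m ∈ r, m.1 ≠ s.last.1) : position l s.last.1 = some s.eps := by
  rw [h, position_append_of_forall_ne hr, s.moves_eq, position_concat, Function.update_self]
  rfl

theorem mem_pebbledPairs_iff {s : Play k A} {t : Play k B} {x : A × B} :
    x ∈ pebbledPairs s t ↔
      ∃ p, position s.moves p = some x.1 ∧ position t.moves p = some x.2 := by
  simp only [position_eq_some_iff]
  rfl

/-- The coextension `f*` on move lists that are allowed to be empty. -/
def coextList (f : Play k A → B) (l : List (Fin k × A)) : List (Fin k × B) :=
  List.ofFn fun i : Fin l.length =>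
    ((l.get i).1, f ⟨l.take (i + 1), by
      have := i.2
      rw [Ne, List.take_eq_nil_iff]
      rintro (h | rfl)
      · omega
      · simp at this⟩)

@[simp]
theorem length_coextList (f : Play k A → B) (l : List (Fin k × A)) :
    (coextList f l).length = l.length := by simp [coextList]

@[simp]
theorem coextList_nil (f : Play k A → B) : coextList f [] = [] := rfl

theorem getElem_coextList (f : Play k A → B) (l : List (Fin k × A)) (i : ℕ) (h : i < l.length) :
    (coextList f l)[i]'(by simpa using h) =
      (l[i].1, f ⟨l.take (i + 1), by rintro h'; simp at h'; simp [h'] at h⟩) := by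
  simp [coextList, -List.ofFn_succ]

@[simp]
theorem coextList_concat (f : Play k A → B) (l : List (Fin k × A)) (m : Fin k × A) :
    coextList f (l ++ [m]) = coextList f l ++ [(m.1, f ⟨l ++ [m], by simp⟩)] := by
  apply List.ext_getElem
  · simp
  · intro i h1 h2
    rw [getElem_coextList _ _ _ (by simpa using h1)]
    rcases Nat.lt_or_ge i l.length with hi | hi
    · rw [List.getElem_append_left (as := coextList f l) (by simpa using hi),
        getElem_coextList _ _ _ hi]
      simp [hi, List.take_append_of_le_length (Nat.succ_le_of_lt hi)]
    · obtain rfl : i = l.length := by simp at h1; omega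
      rw [List.getElem_append_right (as := coextList f l) (by simp)]
      simp [List.take_of_length_le]

theorem coextList_map_fst (f : Play k A → B) (l : List (Fin k × A)) :
    (coextList f l).map Prod.fst = l.map Prod.fst := by
  induction l using List.reverseRecOn with
  | nil => rfl
  | append_singleton l m ih => simp [ih]

theorem position_coextList_eq_none_iff (f : Play k A → B) (l : List (Fin k × A)) (p : Fin k) :
    position (coextList f l) p = none ↔ position l p = none := by
  induction l using List.reverseRecOn with
  | nil => simp
  | append_singleton l m ih =>
    rw [coextList_concat, position_concat, position_concat]
    by_cases hp : p = m.1
    · subst hp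
      simp
    · rw [Function.update_of_ne hp, Function.update_of_ne hp, ih]

/-- The answer of `f` to an element whose pebble has not moved since is still pebbled. -/
theorem position_coextList_of_active {f : Play k A → B} {l r : List (Fin k × A)} {s : Play k A}
    (h : l = s.moves ++ r) (hr : ∀ m ∈ r, m.1 ≠ s.last.1) :
    position (coextList f l) s.last.1 = some (f s) := by
  have hl : l ≠ [] := by simp [h, s.ne_nil]
  obtain ⟨r', h1, h2⟩ := coext_append (f := f) (s := s) (t := ⟨l, hl⟩) h
  have h3 := position_of_active (s := coext f s) h1 fun m hm => by
    obtain ⟨m', hm', h4⟩ := List.mem_map.1 (h2 ▸ List.mem_map_of_mem hm)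
    rw [coext_last, ← h4]
    exact hr m' hm'
  rwa [coext_last, eps_coext] at h3

/-- A list of moves together with the list of answers to it, when each answer is computed by `σ`
from the moves and answers so far and the new move. The moves are returned too because the
recursion needs them. -/
def respond (σ : List (Fin k × A) → List (Fin k × B) → Fin k → A → B) (l : List (Fin k × A)) :
    List (Fin k × A) × List (Fin k × B) :=
  l.foldl (fun st m => (st.1 ++ [m], st.2 ++ [(m.1, σ st.1 st.2 m.1 m.2)])) ([], [])

theorem respond_fst (σ : List (Fin k × A) → List (Fin k × B) → Fin k → A → B)
    (l : List (Fin k × A)) : (respond σ l).1 = l := by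
  induction l using List.reverseRecOn with
  | nil => rfl
  | append_singleton l m ih =>
    rw [respond] at ih
    simp [respond, List.foldl_append, ih]

/-- The function on plays that gives the last answer of `σ`. -/
def strategyOf (σ : List (Fin k × A) → List (Fin k × B) → Fin k → A → B) (s : Play k A) : B :=
  σ s.moves.dropLast (respond σ s.moves.dropLast).2 s.last.1 s.last.2

theorem coextList_strategyOf (σ : List (Fin k × A) → List (Fin k × B) → Fin k → A → B)
    (l : List (Fin k × A)) : coextList (strategyOf σ) l = (respond σ l).2 := by
  induction l using List.reverseRecOn with
  | nil => rfl
  | append_singleton l m ih =>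
    have h := respond_fst σ l
    rw [coextList_concat, ih]
    simp only [respond] at h ⊢
    simp [List.foldl_append, h, strategyOf, Play.last, respond]

theorem coextList_strategyOf_concat
    (σ : List (Fin k × A) → List (Fin k × B) → Fin k → A → B)
    (l : List (Fin k × A)) (p : Fin k) (a : A) :
    coextList (strategyOf σ) (l ++ [(p, a)]) = coextList (strategyOf σ) l ++
      [(p, σ l (coextList (strategyOf σ) l) p a)] := by
  rw [coextList_concat, coextList_strategyOf]
  simp [strategyOf, Play.last]

/-- If every move can be answered without leaving the relation `Good`, then there is a strategy
that never leaves it. -/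
theorem exists_strategy {Good : List (Fin k × A) → List (Fin k × B) → Prop} (h0 : Good [] [])
    (hstep : ∀ l m, Good l m → ∀ p a, ∃ b, Good (l ++ [(p, a)]) (m ++ [(p, b)])) :
    ∃ f : Play k A → B, ∀ l, Good l (coextList f l) := by
  classical
  rcases isEmpty_or_nonempty (Fin k × A) with hA | ⟨⟨p₀, a₀⟩⟩
  · refine ⟨fun s => isEmptyElim s.last, fun l => ?_⟩
    cases l with
    | nil => exact h0
    | cons m _ => exact isEmptyElim m
  · obtain ⟨b₀, -⟩ := hstep [] [] h0 p₀ a₀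
    have hσ : ∀ l m p a, ∃ b, Good l m → Good (l ++ [(p, a)]) (m ++ [(p, b)]) := by
      intro l m p a
      by_cases h : Good l m
      · exact (hstep l m h p a).imp fun b hb _ => hb
      · exact ⟨b₀, fun h' => absurd h' h⟩
    choose σ hσ using hσ
    refine ⟨strategyOf σ, fun l => ?_⟩
    induction l using List.reverseRecOn with
    | nil => exact h0
    | append_singleton l m ih =>
      rw [coextList_strategyOf_concat]
      exact hσ _ _ _ _ ih

/-- A relation between positions with the forth property is respected by a strategy that in
addition inverts a given strategy `g` along a given list of moves. -/
theorem exists_strategy_inverting {R : (Fin k → Option A) → (Fin k → Option B) → Prop}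
    (h0 : R (fun _ => none) fun _ => none)
    (hstep : ∀ e e', R e e' → ∀ p a, ∃ b,
      R (Function.update e p (some a)) (Function.update e' p (some b)))
    {g : Play k B → A} (hg : ∀ m, R (position (coextList g m)) (position m))
    (m₀ : List (Fin k × B)) :
    ∃ f : Play k A → B, (∀ l, R (position l) (position (coextList f l))) ∧
      coextList f (coextList g m₀) = m₀ := by
  obtain ⟨f, hf⟩ := exists_strategy
    (Good := fun l m => R (position l) (position m) ∧
      ∀ m', m' <+: m₀ → l = coextList g m' → m = m')
    ⟨h0, fun m' _ h => by
      have := congrArg List.length h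
      rw [length_coextList] at this
      exact (List.length_eq_zero_iff.1 this.symm).symm⟩
    (by
      rintro l m ⟨h1, h2⟩ p a
      by_cases hex : ∃ m', m' <+: m₀ ∧ l ++ [(p, a)] = coextList g m'
      · obtain ⟨m', hm', hl⟩ := hex
        rcases List.eq_nil_or_concat' m' with rfl | ⟨m'', ⟨q, b⟩, rfl⟩
        · simp at hl
        · have hl' := hl
          rw [coextList_concat] at hl'
          obtain ⟨hl₁, hl₂⟩ := List.append_inj' hl' rfl
          obtain rfl : m = m'' := h2 _ ((List.prefix_append _ _).trans hm') hl₁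
          obtain rfl : p = q := by simpa using congrArg (fun x => x.map Prod.fst) hl₂
          refine ⟨b, hl ▸ hg _, fun m₁ hm₁ h => ?_⟩
          -- two prefixes of `m₀` with the same image under `g*` have the same length
          have hlen := congrArg List.length (hl.symm.trans h)
          rw [length_coextList, length_coextList] at hlen
          exact (List.prefix_of_prefix_length_le hm' hm₁ hlen.le).eq_of_length hlen
      · obtain ⟨b, hb⟩ := hstep _ _ h1 p a
        exact ⟨b, by simpa using hb, fun m' hm' h => absurd ⟨m', hm', h⟩ hex⟩)
  exact ⟨f, fun l => (hf l).1, (hf _).2 m₀ List.prefix_rfl rfl⟩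

/-- If for each pebble some bijection answers all moves without leaving the relation `Good`, then
there are mutually inverse strategies that never leave it. -/
theorem exists_inverse_strategies (hk : 0 < k)
    {Good : List (Fin k × A) → List (Fin k × B) → Prop} (h0 : Good [] [])
    (hstep : ∀ l m, Good l m → ∀ p, ∃ β : A ≃ B, ∀ a, Good (l ++ [(p, a)]) (m ++ [(p, β a)])) :
    ∃ (f : Play k A → B) (g : Play k B → A), (∀ l, Good l (coextList f l)) ∧
      (∀ l, coextList g (coextList f l) = l) ∧ ∀ m, coextList f (coextList g m) = m := by
  classical
  obtain ⟨β₀, -⟩ := hstep [] [] h0 ⟨0, hk⟩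
  have hβ : ∀ l m p, ∃ β : A ≃ B, Good l m → ∀ a, Good (l ++ [(p, a)]) (m ++ [(p, β a)]) := by
    intro l m p
    by_cases h : Good l m
    · exact (hstep l m h p).imp fun b hb _ => hb
    · exact ⟨β₀, fun h' => absurd h' h⟩
  choose β hβ using hβ
  refine ⟨strategyOf fun l m p a => β l m p a, strategyOf fun m l p b => (β l m p).symm b,
    fun l => ?_, fun l => ?_, fun m => ?_⟩
  · induction l using List.reverseRecOn with
    | nil => exact h0
    | append_singleton l m ih =>
      rw [coextList_strategyOf_concat]
      exact hβ _ _ _ ih _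
  · induction l using List.reverseRecOn with
    | nil => rfl
    | append_singleton l m ih =>
      rw [coextList_strategyOf_concat, coextList_strategyOf_concat, ih]
      simp
  · induction m using List.reverseRecOn with
    | nil => rfl
    | append_singleton m x ih =>
      rw [coextList_strategyOf_concat, coextList_strategyOf_concat, ih]
      simp

theorem coext_coext_eq_self_iff {f : Play k A → B} {g : Play k B → A} :
    (∀ s, coext g (coext f s) = s) ↔ ∀ l, coextList g (coextList f l) = l := by
  constructor
  · intro h l
    rcases eq_or_ne l [] with rfl | hl
    · rfl
    · exact congrArg Play.moves (h ⟨l, hl⟩)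
  · exact fun h s => Play.ext (h s.moves)

end Lists

/-! ### Preservation of relations and equality at positions -/

section Atoms

open FirstOrder.Language.Structure

variable {k : ℕ} {A B : Type w}

/-- The same pebbles are placed in both positions. -/
def SameDom (e : Fin k → Option A) (e' : Fin k → Option B) : Prop :=
  ∀ p, e p = none ↔ e' p = none

theorem SameDom.symm {e : Fin k → Option A} {e' : Fin k → Option B} (h : SameDom e e') :
    SameDom e' e := fun p => (h p).symm

theorem SameDom.update {e : Fin k → Option A} {e' : Fin k → Option B} (h : SameDom e e')
    (p : Fin k) (a : A) (b : B) :
    SameDom (Function.update e p (some a)) (Function.update e' p (some b)) := by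
  intro q
  rcases eq_or_ne q p with rfl | hq
  · simp
  · rw [Function.update_of_ne hq, Function.update_of_ne hq, h q]

theorem SameDom.exists_of_forall {e : Fin k → Option A} {e' : Fin k → Option B}
    (h : SameDom e e') {n : ℕ} {x : Fin n → Fin k} {a : Fin n → A}
    (ha : ∀ i, e (x i) = some (a i)) : ∃ b : Fin n → B, ∀ i, e' (x i) = some (b i) := by
  have : ∀ i, ∃ b, e' (x i) = some b := fun i =>
    Option.ne_none_iff_exists'.1 fun h' => by simpa [ha i] using (h (x i)).2 h'
  exact ⟨fun i => (this i).choose, fun i => (this i).choose_spec⟩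

theorem sameDom_coextList (f : Play k A → B) (l : List (Fin k × A)) :
    SameDom (position l) (position (coextList f l)) :=
  fun p => (position_coextList_eq_none_iff f l p).symm

variable (L : FirstOrder.Language.{u, v}) [L.Structure A] [L.Structure B]

/-- The relations are preserved when each element under a pebble in the first position is replaced
by the element under the same pebble in the second. -/
def PreservesRel (e : Fin k → Option A) (e' : Fin k → Option B) : Prop :=
  ∀ (n : ℕ) (R : L.Relations n) (x : Fin n → Fin k) (a : Fin n → A) (b : Fin n → B),
    (∀ i, e (x i) = some (a i)) → (∀ i, e' (x i) = some (b i)) → RelMap R a → RelMap R b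

/-- Pebbles that lie on the same element in the first position do so in the second. -/
def PreservesEq {X Y : Type*} (e : Fin k → Option X) (e' : Fin k → Option Y) : Prop :=
  ∀ i j a, e i = some a → e j = some a → e' i = e' j

variable {L}

/-- A strategy that preserves the relations at all positions is a homomorphism on plays: a tuple in
a relation of `ℙ_k A` is non-empty, as there are no `0`-ary relations, so it has a longest member,
and all members are active in that one. -/
theorem preservesRel_imp_relMap [IsEmpty (L.Relations 0)] [L.IsRelational] {f : Play k A → B}
    (hf : ∀ l, PreservesRel L (position l) (position (coextList f l))) {n : ℕ}
    (R : L.Relations n) (s : Fin n → Play k A) (hs : RelMap R s) : RelMap R (f ∘ s) := by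
  obtain ⟨h1, h2, h3⟩ := hs
  rcases Nat.eq_zero_or_pos n with rfl | hn
  · exact isEmptyElim R
  have : Nonempty (Fin n) := ⟨⟨0, hn⟩⟩
  obtain ⟨j, hj⟩ := Finite.exists_max fun i => (s i).moves.length
  have hpre : ∀ i, (s i).moves <+: (s j).moves := fun i => by
    rcases h1 i j with h | h
    · exact h
    · rw [h.eq_of_length (le_antisymm h.length_le (hj i))]
  choose r hr using hpre
  exact hf (s j).moves n R (fun i => (s i).last.1) _ _
    (fun i => position_of_active (hr i).symm (h2 i j (r i) (hr i).symm))
    (fun i => position_coextList_of_active (hr i).symm (h2 i j (r i) (hr i).symm)) h3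

/-- Conversely, homomorphisms on plays preserve the relations at all positions: the prefixes that
end with the last move of each pebble are active in the whole play. -/
theorem preservesRel_coextList [L.IsRelational] (f : Play k A →[L] B) (l : List (Fin k × A)) :
    PreservesRel L (position l) (position (coextList f l)) := by
  intro n R x a b ha hb hR
  have hex : ∀ i, ∃ (s : Play k A) (r : List (Fin k × A)), l = s.moves ++ r ∧
      s.last = (x i, a i) ∧ ∀ m ∈ r, m.1 ≠ s.last.1 := fun i => by
    obtain ⟨q, r, h1, h2⟩ := position_eq_some_iff.1 (ha i)
    exact ⟨⟨q ++ [(x i, a i)], by simp⟩, r, by simp [h1], by simp [Play.last],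
      by simpa [Play.last] using h2⟩
  choose s r h1 h2 h3 using hex
  have hs : RelMap R s := by
    refine ⟨fun i j => List.prefix_or_prefix_of_prefix ⟨r i, (h1 i).symm⟩ ⟨r j, (h1 j).symm⟩,
      fun i j q hq m hm => ?_, ?_⟩
    · have h4 : r i = q ++ r j := by
        apply List.append_cancel_left (as := (s i).moves)
        rw [← h1 i, ← List.append_assoc, ← hq, ← h1 j]
      exact h3 i m (by simp [h4, hm])
    · convert hR with i
      exact congrArg Prod.snd (h2 i)
  have hb' : b = f ∘ s := by
    funext i
    have h4 := position_coextList_of_active (f := f) (h1 i) (h3 i)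
    rw [h2 i] at h4
    exact Option.some_injective _ ((hb i).symm.trans h4)
  rw [hb']
  exact f.map_rel R s hs

end Atoms

/-! ### Soundness of the pebble games -/

section Soundness

open InfFormula FirstOrder.Language.Structure Function

variable {L : FirstOrder.Language.{u, v}} {k : ℕ} {A B : Type w} [L.Structure A] [L.Structure B]

theorem PreservesRel.realize {e : Fin k → Option A} {e' : Fin k → Option B}
    (h : PreservesRel L e e') (hd : SameDom e e') {n : ℕ} {R : L.Relations n}
    {x : Fin n → Fin k} (hR : (rel R x : InfFormula.{u, v, w} L k).Realize e) :
    (rel R x : InfFormula.{u, v, w} L k).Realize e' := by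
  obtain ⟨a, ha, hRa⟩ := hR
  obtain ⟨b, hb⟩ := hd.exists_of_forall ha
  exact ⟨b, hb, h n R x a b ha hb hRa⟩

theorem PreservesEq.realize {e : Fin k → Option A} {e' : Fin k → Option B}
    (h : PreservesEq e e') (hd : SameDom e e') {i j : Fin k}
    (hij : (equal i j : InfFormula.{u, v, w} L k).Realize e) :
    (equal i j : InfFormula.{u, v, w} L k).Realize e' := by
  obtain ⟨a, hi, hj⟩ := hij
  obtain ⟨b, hb⟩ := Option.ne_none_iff_exists'.1 fun h' : e' i = none => by
    simpa [hi] using (hd i).2 h'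
  exact ⟨b, hb, (h i j a hi hj).symm.trans hb⟩

/-- A forth system of partial homomorphisms preserves the existential positive formulas. -/
theorem realize_of_forth {H : (Fin k → Option A) → (Fin k → Option B) → Prop}
    (hdom : ∀ e e', H e e' → SameDom e e') (hrel : ∀ e e', H e e' → PreservesRel L e e')
    (heq : ∀ e e', H e e' → PreservesEq e e')
    (hforth : ∀ e e', H e e' → ∀ p a, ∃ b, H (update e p (some a)) (update e' p (some b)))
    (φ : InfFormula.{u, v, w} L k) (hφ : φ.ExistentialPositive) :
    ∀ e e', H e e' → φ.Realize e → φ.Realize e' := by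
  induction φ with
  | rel R x => exact fun e e' h => (hrel e e' h).realize (hdom e e' h)
  | equal i j => exact fun e e' h => (heq e e' h).realize (hdom e e' h)
  | conj φ ih => exact fun e e' h hr c => ih c (hφ c) e e' h (hr c)
  | disj φ ih => exact fun e e' h ⟨c, hr⟩ => ⟨c, ih c (hφ c) e e' h hr⟩
  | ex p φ ih =>
    rintro e e' h ⟨a, ha⟩
    obtain ⟨b, hb⟩ := hforth e e' h p a
    exact ⟨b, ih hφ _ _ hb ha⟩
  | neg => exact hφ.elim
  | all => exact hφ.elim
  | exGe => exact hφ.elim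
  | exLe => exact hφ.elim

/-- A back-and-forth system of partial isomorphisms preserves the formulas without counting
quantifiers. -/
theorem realize_iff_of_backAndForth {H : (Fin k → Option A) → (Fin k → Option B) → Prop}
    (hdom : ∀ e e', H e e' → SameDom e e')
    (hrel : ∀ e e', H e e' → PreservesRel L e e' ∧ PreservesRel L e' e)
    (heq : ∀ e e', H e e' → PreservesEq e e' ∧ PreservesEq e' e)
    (hforth : ∀ e e', H e e' → ∀ p a, ∃ b, H (update e p (some a)) (update e' p (some b)))
    (hback : ∀ e e', H e e' → ∀ p b, ∃ a, H (update e p (some a)) (update e' p (some b)))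
    (φ : InfFormula.{u, v, w} L k) (hφ : φ.CountingFree) :
    ∀ e e', H e e' → (φ.Realize e ↔ φ.Realize e') := by
  induction φ with
  | rel R x =>
    exact fun e e' h => ⟨(hrel e e' h).1.realize (hdom e e' h),
      (hrel e e' h).2.realize (hdom e e' h).symm⟩
  | equal i j =>
    exact fun e e' h => ⟨(heq e e' h).1.realize (hdom e e' h),
      (heq e e' h).2.realize (hdom e e' h).symm⟩
  | neg φ ih => exact fun e e' h => not_congr (ih hφ e e' h)
  | conj φ ih => exact fun e e' h => forall_congr' fun c => ih c (hφ c) e e' h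
  | disj φ ih => exact fun e e' h => exists_congr fun c => ih c (hφ c) e e' h
  | ex p φ ih =>
    refine fun e e' h => ⟨fun ⟨a, ha⟩ => ?_, fun ⟨b, hb⟩ => ?_⟩
    · obtain ⟨b, hb⟩ := hforth e e' h p a
      exact ⟨b, (ih hφ _ _ hb).1 ha⟩
    · obtain ⟨a, ha⟩ := hback e e' h p b
      exact ⟨a, (ih hφ _ _ ha).2 hb⟩
  | all p φ ih =>
    refine fun e e' h => ⟨fun hr b => ?_, fun hr a => ?_⟩
    · obtain ⟨a, ha⟩ := hback e e' h p b
      exact (ih hφ _ _ ha).1 (hr a)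
    · obtain ⟨b, hb⟩ := hforth e e' h p a
      exact (ih hφ _ _ hb).2 (hr b)
  | exGe => exact hφ.elim
  | exLe => exact hφ.elim

variable (L) in
/-- A relation between positions from which all moves of a pebble can be answered through a
bijection, and in which the relations, but not necessarily equality, are preserved and reflected. -/
structure IsBijectiveSystem (H : (Fin k → Option A) → (Fin k → Option B) → Prop) : Prop where
  dom : ∀ e e', H e e' → SameDom e e'
  rel : ∀ e e', H e e' → PreservesRel L e e'
  rel_symm : ∀ e e', H e e' → PreservesRel L e' e
  bij : ∀ e e', H e e' → ∀ p, ∃ β : A ≃ B, ∀ a,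
    H (update e p (some a)) (update e' p (some (β a)))

/-- If equality is preserved and reflected too, a bijective system preserves all formulas with
counting quantifiers. -/
theorem IsBijectiveSystem.realize_iff {H : (Fin k → Option A) → (Fin k → Option B) → Prop}
    (hH : IsBijectiveSystem L H) (heq : ∀ e e', H e e' → PreservesEq e e' ∧ PreservesEq e' e)
    (φ : InfFormula.{u, v, w} L k) : ∀ e e', H e e' → (φ.Realize e ↔ φ.Realize e') := by
  have key : ∀ (φ : InfFormula.{u, v, w} L k) (p : Fin k),
      (∀ e e', H e e' → (φ.Realize e ↔ φ.Realize e')) → ∀ e e', H e e' →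
      {a | φ.Realize (update e p (some a))}.encard =
        {b | φ.Realize (update e' p (some b))}.encard := by
    intro φ p ih e e' h
    obtain ⟨β, hβ⟩ := hH.bij e e' h p
    rw [← β.injective.encard_image]
    congr 1
    ext b
    obtain ⟨a, rfl⟩ := β.surjective b
    rw [β.injective.mem_set_image]
    exact ih _ _ (hβ a)
  induction φ with
  | rel R x =>
    exact fun e e' h => ⟨(hH.rel e e' h).realize (hH.dom e e' h),
      (hH.rel_symm e e' h).realize (hH.dom e e' h).symm⟩
  | equal i j =>
    exact fun e e' h => ⟨(heq e e' h).1.realize (hH.dom e e' h),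
      (heq e e' h).2.realize (hH.dom e e' h).symm⟩
  | neg φ ih => exact fun e e' h => not_congr (ih e e' h)
  | conj φ ih => exact fun e e' h => forall_congr' fun c => ih c e e' h
  | disj φ ih => exact fun e e' h => exists_congr fun c => ih c e e' h
  | ex p φ ih =>
    intro e e' h
    obtain ⟨β, hβ⟩ := hH.bij e e' h p
    exact β.exists_congr fun a => ih _ _ (hβ a)
  | all p φ ih =>
    intro e e' h
    obtain ⟨β, hβ⟩ := hH.bij e e' h p
    exact β.forall_congr fun {a} => ih _ _ (hβ a)
  | exGe n p φ ih =>
    intro e e' h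
    simp only [Realize, key φ p ih e e' h]
  | exLe n p φ ih =>
    intro e e' h
    simp only [Realize, key φ p ih e e' h]

end Soundness

/-! ### Positions that satisfy the same formulas -/

section Completeness

open InfFormula FirstOrder.Language.Structure Function

variable {L : FirstOrder.Language.{u, v}} {k : ℕ} {A B : Type w} [L.Structure A] [L.Structure B]
  {P : InfFormula.{u, v, w} L k → Prop} {e : Fin k → Option A} {e' : Fin k → Option B}

/-- The formulas of the fragment `P` whose free variables are assigned and that hold in the first
position hold in the second position. -/
structure Transfers (P : InfFormula.{u, v, w} L k → Prop) (e : Fin k → Option A)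
    (e' : Fin k → Option B) : Prop where
  dom : SameDom e e'
  realize : ∀ φ, P φ → (∀ p ∈ φ.freeVars, e p ≠ none) → φ.Realize e → φ.Realize e'

theorem Transfers.symm (hneg : ∀ φ, P φ → P φ.neg) (h : Transfers P e e') : Transfers P e' e where
  dom := h.dom.symm
  realize φ hφ hfv hr := by
    by_contra hn
    exact h.realize φ.neg (hneg φ hφ) (fun p hp => mt (h.dom p).1 (hfv p hp)) hn hr

theorem transfers_none (h : ∀ φ : InfFormula.{u, v, w} L k, φ.IsSentence → P φ →
    φ.Holds A → φ.Holds B) :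
    Transfers P (fun _ => (none : Option A)) fun _ => (none : Option B) where
  dom _ := by simp
  realize φ hφ hfv :=
    h φ (Set.eq_empty_iff_forall_notMem.2 fun p hp => hfv p hp rfl) hφ

theorem Transfers.preservesRel (h : Transfers P e e')
    (hP : ∀ {n : ℕ} (R : L.Relations n) (x : Fin n → Fin k), P (rel R x)) :
    PreservesRel L e e' := by
  intro n R x a b ha hb hR
  obtain ⟨b', hb', hR'⟩ := h.realize (rel R x) (hP R x)
    (by rintro _ ⟨i, rfl⟩; simp [ha]) ⟨a, ha, hR⟩
  have : b = b' := funext fun i => Option.some_injective _ ((hb i).symm.trans (hb' i))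
  rwa [this]

theorem Transfers.preservesEq (h : Transfers P e e') (hP : ∀ i j, P (equal i j)) :
    PreservesEq e e' := by
  intro i j a hi hj
  obtain ⟨b, hi', hj'⟩ := h.realize (equal i j) (hP i j)
    (by rintro _ (rfl | rfl) <;> simp [hi, hj]) ⟨a, hi, hj⟩
  rw [hi', hj']

/-- A move that could not be answered would be described by the formula `∃ p, ⋀ b, χ b`, where
`χ b` shows that the answer `b` is wrong. -/
theorem Transfers.forth (h : Transfers P e e')
    (hconj : ∀ {ι : Type w} (φ : ι → InfFormula.{u, v, w} L k), (∀ c, P (φ c)) → P (conj φ))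
    (hex : ∀ p φ, P φ → P (ex p φ)) (p : Fin k) (a : A) :
    ∃ b, Transfers P (update e p (some a)) (update e' p (some b)) := by
  by_contra! hcon
  have : ∀ b, ∃ φ, P φ ∧ (∀ q ∈ φ.freeVars, update e p (some a) q ≠ none) ∧
      φ.Realize (update e p (some a)) ∧ ¬ φ.Realize (update e' p (some b)) := by
    intro b
    by_contra! hb
    exact hcon b ⟨h.dom.update p a b, hb⟩
  choose χ h1 h2 h3 h4 using this
  obtain ⟨b, hb⟩ := h.realize (ex p (conj χ)) (hex p _ (hconj χ h1))
    (by
      rintro q ⟨hq, hqp⟩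
      obtain ⟨b, hb⟩ := Set.mem_iUnion.1 hq
      simpa [update_of_ne (show q ≠ p from hqp)] using h2 b q hb) ⟨a, h3⟩
  exact h4 b (hb b)

/-- Between finite structures, the moves of a pebble can be answered through a bijection: a
formula isolates the type of the new position among the finitely many that can arise, and the
counting quantifiers say how many elements have this type. -/
theorem Transfers.exists_equiv [Finite A] [Finite B]
    (h : Transfers (fun _ : InfFormula.{u, v, w} L k => True) e e') (p : Fin k) :
    ∃ β : A ≃ B, ∀ a, Transfers (fun _ : InfFormula.{u, v, w} L k => True)
      (update e p (some a)) (update e' p (some (β a))) := by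
  classical
  -- the type of a new position: the formulas in the variables `V`, all assigned, that it satisfies
  let V : Set (Fin k) := {q | q = p ∨ e q ≠ none}
  let tA : A → Set (InfFormula.{u, v, w} L k) := fun a =>
    {φ | φ.freeVars ⊆ V ∧ φ.Realize (update e p (some a))}
  let tB : B → Set (InfFormula.{u, v, w} L k) := fun b =>
    {φ | φ.freeVars ⊆ V ∧ φ.Realize (update e' p (some b))}
  let t : A ⊕ B → Set (InfFormula.{u, v, w} L k) := Sum.elim tA tB
  have hneg : ∀ x φ, φ.freeVars ⊆ V → φ ∉ t x → φ.neg ∈ t x := by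
    rintro (a | b) φ hφ hn
    · exact ⟨hφ, fun hr => hn ⟨hφ, hr⟩⟩
    · exact ⟨hφ, fun hr => hn ⟨hφ, hr⟩⟩
  have hneg' : ∀ x φ, φ ∈ t x → φ.neg ∉ t x := by
    rintro (a | b) φ h1 h2
    · exact h2.2 h1.2
    · exact h2.2 h1.2
  have hV : ∀ x, ∀ φ ∈ t x, φ.freeVars ⊆ V := by
    rintro (a | b) φ hφ
    · exact hφ.1
    · exact hφ.1
  -- two elements of different types are separated by a formula that holds at the first one
  have hsep : ∀ x y, ∃ χ ∈ t x, χ ∈ t y → t y = t x := by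
    intro x y
    by_cases hxy : t y = t x
    · refine ⟨conj (ι := PEmpty) PEmpty.elim, ?_, fun _ => hxy⟩
      rcases x with a | b
      · exact ⟨by simp [freeVars], fun c => c.elim⟩
      · exact ⟨by simp [freeVars], fun c => c.elim⟩
    · by_cases hsub : t x ⊆ t y
      · obtain ⟨φ, hφ, hφ'⟩ := Set.not_subset.1 fun h' => hxy (h'.antisymm hsub)
        exact ⟨φ.neg, hneg x φ (hV y φ hφ) hφ', fun h' => absurd h' (hneg' y φ hφ)⟩
      · obtain ⟨φ, hφ, hφ'⟩ := Set.not_subset.1 hsub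
        exact ⟨φ, hφ, fun h' => absurd h' hφ'⟩
  have hcard : ∀ τ, Nonempty ({a // tA a = τ} ≃ {b // tB b = τ}) := by
    intro τ
    by_cases hτ : ∃ x, t x = τ
    · obtain ⟨x, rfl⟩ := hτ
      choose χ h1 h2 using hsep x
      -- `conj χ` isolates the type of `x`
      have h3 : (conj χ).freeVars ⊆ V := Set.iUnion_subset fun y => hV x _ (h1 y)
      have h4 : conj χ ∈ t x := by
        rcases x with a | b
        · exact ⟨h3, fun y => (h1 y).2⟩
        · exact ⟨h3, fun y => (h1 y).2⟩
      have hA : ∀ a, (conj χ).Realize (update e p (some a)) ↔ tA a = t x := fun a =>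
        ⟨fun hr => h2 (Sum.inl a) ⟨hV x _ (h1 _), hr (Sum.inl a)⟩,
          fun h' => (show conj χ ∈ tA a from h' ▸ h4).2⟩
      have hB : ∀ b, (conj χ).Realize (update e' p (some b)) ↔ tB b = t x := fun b =>
        ⟨fun hr => h2 (Sum.inr b) ⟨hV x _ (h1 _), hr (Sum.inr b)⟩,
          fun h' => (show conj χ ∈ tB b from h' ▸ h4).2⟩
      have hfv : ∀ q ∈ (conj χ).freeVars \ {p}, e q ≠ none := fun q hq =>
        (h3 hq.1).resolve_left hq.2
      have hn : ((Set.toFinite {a | tA a = t x}).toFinset.card : ℕ∞) =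
          {a | tA a = t x}.encard :=
        (Set.Finite.encard_eq_coe_toFinset_card _).symm
      have hge := h.realize (exGe _ p (conj χ)) trivial hfv
        (by simp only [Realize.eq_8, hA]; exact hn.le)
      have hle := h.realize (exLe _ p (conj χ)) trivial hfv
        (by simp only [Realize.eq_9, hA]; exact hn.ge)
      simp only [Realize.eq_8, hB] at hge
      simp only [Realize.eq_9, hB] at hle
      have heq : {a | tA a = t x}.encard = {b | tB b = t x}.encard :=
        hn.symm.trans (le_antisymm hge hle)
      exact Finite.card_eq.1 (congrArg ENat.toNat heq)
    · have hA : IsEmpty {a // tA a = τ} := ⟨fun a => hτ ⟨Sum.inl a.1, a.2⟩⟩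
      have hB : IsEmpty {b // tB b = τ} := ⟨fun b => hτ ⟨Sum.inr b.1, b.2⟩⟩
      exact ⟨Equiv.equivOfIsEmpty _ _⟩
  refine ⟨Equiv.ofFiberEquiv fun τ => (hcard τ).some, fun a => ⟨h.dom.update p _ _, ?_⟩⟩
  intro φ _ hfv hr
  have ht : tB _ = tA a := Equiv.ofFiberEquiv_map (fun τ => (hcard τ).some) a
  have hφ : φ ∈ tA a := by
    refine ⟨fun q hq => ?_, hr⟩
    by_cases hqp : q = p
    · exact Or.inl hqp
    · exact Or.inr (by simpa [update_of_ne hqp] using hfv q hq)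
  rw [← ht] at hφ
  exact hφ.2

end Completeness

/-! ### Existential positive logic -/

section ExistentialPositive

open FirstOrder.Language.Structure Function

variable {k : ℕ} {A B : Type w}

theorem exists_forall_ne_apply (ρ : Fin k → Fin k) (p : Fin k) : ∃ r, ∀ q ≠ p, ρ q ≠ r := by
  by_contra! h
  have hcard := Finset.card_image_le (s := Finset.univ.erase p) (f := ρ)
  rw [Finset.eq_univ_of_forall (s := (Finset.univ.erase p).image ρ) fun r => by
    obtain ⟨q, hq, rfl⟩ := h r
    exact Finset.mem_image_of_mem _ (by simpa using hq),
    Finset.card_erase_of_mem (Finset.mem_univ p)] at hcard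
  have := p.pos
  simp at hcard
  omega

theorem update_comp_update {X : Type*} (e : Fin k → X) {ρ : Fin k → Fin k} {p r : Fin k}
    (h : ∀ q ≠ p, ρ q ≠ r) (x : X) :
    update e r x ∘ update ρ p r = update (e ∘ ρ) p x := by
  funext q
  rcases eq_or_ne q p with rfl | hq
  · simp
  · simp [update_of_ne hq, update_of_ne (h q hq)]

theorem comp_update_of_eq {X : Type*} {e : Fin k → X} {ρ : Fin k → Fin k} {p r : Fin k} {x : X}
    (h : e r = x) : e ∘ update ρ p r = update (e ∘ ρ) p x := by
  rw [comp_update, h]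

theorem SameDom.comp {e : Fin k → Option A} {e' : Fin k → Option B} (h : SameDom e e')
    (ρ : Fin k → Fin k) : SameDom (e ∘ ρ) (e' ∘ ρ) := fun p => h (ρ p)

theorem PreservesEq.update {X Y : Type*} {e : Fin k → Option X} {e' : Fin k → Option Y}
    (h : PreservesEq e e') {p : Fin k} {a : X} {b : Y}
    (hq : ∀ q ≠ p, e q = some a → e' q = some b) :
    PreservesEq (update e p (some a)) (update e' p (some b)) := by
  intro i j c hi hj
  rcases eq_or_ne i p with rfl | hip <;> rcases eq_or_ne j i with rfl | hij
  · rfl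
  · obtain rfl : a = c := by simpa using hi
    rw [update_of_ne hij] at hj ⊢
    simp [hq j hij hj]
  · rfl
  · rw [update_of_ne hip] at hi ⊢
    rcases eq_or_ne j p with rfl | hjp
    · obtain rfl : a = c := by simpa using hj
      simp [hq i hip hi]
    · rw [update_of_ne hjp] at hj ⊢
      exact h i j c hi hj

variable {L : FirstOrder.Language.{u, v}} [L.Structure A] [L.Structure B]

theorem PreservesRel.comp {e : Fin k → Option A} {e' : Fin k → Option B}
    (h : PreservesRel L e e') (ρ : Fin k → Fin k) : PreservesRel L (e ∘ ρ) (e' ∘ ρ) :=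
  fun n R x a b ha hb hR => h n R (ρ ∘ x) a b ha hb hR

/-- A homomorphism on plays need not preserve equality of pebbled elements. Therefore the logical
game is played on positions that are pulled back from positions of the game of `f` along a
renaming `ρ` of the pebbles that identifies the pebbles on equal elements. A pebble that moves to
an already pebbled element is only renamed; for any other move, some pebble is free in the game
of `f`. -/
theorem realize_of_hom [L.IsRelational] (f : Play k A →[L] B) {φ : InfFormula.{u, v, w} L k}
    (hφ : φ.ExistentialPositive) : φ.Holds A → φ.Holds B := by
  refine realize_of_forth (H := fun e e' => ∃ (l : List (Fin k × A)) (ρ : Fin k → Fin k),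
    e = position l ∘ ρ ∧ e' = position (coextList f l) ∘ ρ ∧
      PreservesEq e (some ∘ ρ)) ?_ ?_ ?_ ?_ φ hφ _ _
    ⟨[], id, rfl, rfl, fun i j a hi => by simp at hi⟩
  · rintro _ _ ⟨l, ρ, rfl, rfl, -⟩
    exact (sameDom_coextList f l).comp ρ
  · rintro _ _ ⟨l, ρ, rfl, rfl, -⟩
    exact (preservesRel_coextList f l).comp ρ
  · rintro _ _ ⟨l, ρ, rfl, rfl, h⟩ i j a hi hj
    exact congrArg (position (coextList f l)) (Option.some_injective _ (h i j a hi hj))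
  · rintro _ _ ⟨l, ρ, rfl, rfl, h⟩ p a
    -- the condition on the renaming, reduced to the pebbles other than `p`
    have key : ∀ r, (∀ q ≠ p, position l (ρ q) = some a → ρ q = r) →
        PreservesEq (update (position l ∘ ρ) p (some a)) (some ∘ update ρ p r) := by
      intro r hr
      rw [comp_update]
      exact h.update fun q hq h' => congrArg some (hr q hq h')
    by_cases hex : ∃ q ≠ p, position l (ρ q) = some a
    · obtain ⟨q, hqp, hq⟩ := hex
      obtain ⟨b, hb⟩ : ∃ b, position (coextList f l) (ρ q) = some b :=
        Option.ne_none_iff_exists'.1 fun h' => by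
          simpa [hq] using (sameDom_coextList f l (ρ q)).2 h'
      exact ⟨b, l, update ρ p (ρ q), (comp_update_of_eq hq).symm, (comp_update_of_eq hb).symm,
        key _ fun q' hq' h' => Option.some_injective _ (h q' q a h' hq)⟩
    · obtain ⟨r, hr⟩ := exists_forall_ne_apply ρ p
      refine ⟨f ⟨l ++ [(r, a)], by simp⟩, l ++ [(r, a)], update ρ p r, ?_, ?_,
        key _ fun q' hq' h' => absurd ⟨q', hq', h'⟩ hex⟩
      · rw [position_concat, update_comp_update _ hr]
      · rw [coextList_concat, position_concat, update_comp_update _ hr]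

theorem exists_hom_of_transfers [L.IsRelational] [IsEmpty (L.Relations 0)]
    (h : ∀ φ : InfFormula.{u, v, w} L k, φ.IsSentence → φ.ExistentialPositive →
      φ.Holds A → φ.Holds B) : Nonempty (Play k A →[L] B) := by
  obtain ⟨f, hf⟩ := exists_strategy (A := A) (B := B)
    (Good := fun l m => Transfers (InfFormula.ExistentialPositive (L := L) (k := k))
      (position l) (position m))
    (transfers_none h) fun l m hlm p a => by
      simpa using hlm.forth (fun _ h => h) (fun _ _ h => h) p a
  exact ⟨⟨f, fun g => isEmptyElim g, fun R s hs =>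
    preservesRel_imp_relMap (fun l => (hf l).preservesRel fun _ _ => trivial) R s hs⟩⟩

theorem exPosEquiv_iff [L.IsRelational] [IsEmpty (L.Relations 0)] :
    ExPosEquiv.{u, v, w} L k A B ↔ KlMorphismsBothWays L k A B :=
  ⟨fun h => ⟨exists_hom_of_transfers fun φ h1 h2 => (h φ h1 h2).1,
    exists_hom_of_transfers fun φ h1 h2 => (h φ h1 h2).2⟩,
  fun ⟨⟨f⟩, ⟨g⟩⟩ _ _ hφ => ⟨realize_of_hom f hφ, realize_of_hom g hφ⟩⟩

end ExistentialPositive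

/-! ### Logic without counting quantifiers -/

section BackAndForth

open FirstOrder.Language.Structure Function

variable {k : ℕ} {A B : Type w} {L : FirstOrder.Language.{u, v}} [L.Structure A] [L.Structure B]

theorem isPartialIso_pebbledPairs_iff {s : Play k A} {t : Play k B}
    (hd : SameDom (position s.moves) (position t.moves)) :
    IsPartialIso (L := L) (pebbledPairs s t) ↔
      (PreservesEq (position s.moves) (position t.moves) ∧
        PreservesEq (position t.moves) (position s.moves)) ∧
      PreservesRel L (position s.moves) (position t.moves) ∧
        PreservesRel L (position t.moves) (position s.moves) := by
  have hl : ∀ p a, position s.moves p = some a → ∃ b, position t.moves p = some b :=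
    fun p a h => Option.ne_none_iff_exists'.1 fun h' => by simpa [h] using (hd p).2 h'
  have hr : ∀ p b, position t.moves p = some b → ∃ a, position s.moves p = some a :=
    fun p a h => Option.ne_none_iff_exists'.1 fun h' => by simpa [h] using (hd p).1 h'
  constructor
  · rintro ⟨h1, h2⟩
    refine ⟨⟨fun i j a hi hj => ?_, fun i j b hi hj => ?_⟩,
      fun n R x a b ha hb hR => ?_, fun n R x b a hb ha hR => ?_⟩
    · obtain ⟨b, hb⟩ := hl i a hi
      obtain ⟨c, hc⟩ := hl j a hj
      rw [hb, hc, show b = c from (h1 (a, b) (mem_pebbledPairs_iff.2 ⟨i, hi, hb⟩) (a, c)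
        (mem_pebbledPairs_iff.2 ⟨j, hj, hc⟩)).1 rfl]
    · obtain ⟨a, ha⟩ := hr i b hi
      obtain ⟨c, hc⟩ := hr j b hj
      rw [ha, hc, show a = c from (h1 (a, b) (mem_pebbledPairs_iff.2 ⟨i, ha, hi⟩) (c, b)
        (mem_pebbledPairs_iff.2 ⟨j, hc, hj⟩)).2 rfl]
    · exact (h2 n R (fun i => (a i, b i))
        fun i => mem_pebbledPairs_iff.2 ⟨x i, ha i, hb i⟩).1 hR
    · exact (h2 n R (fun i => (a i, b i))
        fun i => mem_pebbledPairs_iff.2 ⟨x i, ha i, hb i⟩).2 hR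
  · rintro ⟨⟨h1, h2⟩, h3, h4⟩
    refine ⟨?_, fun n R x hx => ?_⟩
    · rintro ⟨a, b⟩ hx ⟨c, d⟩ hy
      obtain ⟨i, hi, hi'⟩ := mem_pebbledPairs_iff.1 hx
      obtain ⟨j, hj, hj'⟩ := mem_pebbledPairs_iff.1 hy
      dsimp only at hi hi' hj hj' ⊢
      constructor
      · rintro rfl
        exact Option.some_injective _ (hi'.symm.trans ((h1 i j a hi hj).trans hj'))
      · rintro rfl
        exact Option.some_injective _ (hi.symm.trans ((h2 i j b hi' hj').trans hj))
    · choose p hp hp' using fun i => mem_pebbledPairs_iff.1 (hx i)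
      exact ⟨h3 n R p _ _ hp hp', h4 n R p _ _ hp' hp⟩

/-- The game has not started yet at the empty list, which no play represents; the condition holds
there because there are no `0`-ary relations. -/
theorem preservesRel_nil [IsEmpty (L.Relations 0)] :
    PreservesRel L (position ([] : List (Fin k × A))) (position ([] : List (Fin k × B))) := by
  intro n R x a b ha hb hR
  cases n with
  | zero => exact isEmptyElim R
  | succ n => simpa using ha 0

/-- Winning strategies are those that lead to partial isomorphisms at all positions. -/
theorem mem_strategies_iff [IsEmpty (L.Relations 0)] {f : Play k A → B} :
    f ∈ strategies L k A B ↔ ∀ l,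
      (PreservesEq (position l) (position (coextList f l)) ∧
        PreservesEq (position (coextList f l)) (position l)) ∧
      PreservesRel L (position l) (position (coextList f l)) ∧
        PreservesRel L (position (coextList f l)) (position l) := by
  constructor
  · intro h l
    rcases eq_or_ne l [] with rfl | hl
    · exact ⟨⟨fun _ _ _ _ _ => rfl, fun _ _ _ _ _ => rfl⟩, preservesRel_nil, preservesRel_nil⟩
    · exact (isPartialIso_pebbledPairs_iff (sameDom_coextList f l)).1 (h ⟨l, hl⟩).2
  · exact fun h s => ⟨(coextList_map_fst f s.moves).symm,
      (isPartialIso_pebbledPairs_iff (sameDom_coextList f s.moves)).2 (h s.moves)⟩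

theorem varEquiv_of_backAndForth [IsEmpty (L.Relations 0)] (h : BackAndForth L k A B) :
    VarEquiv.{u, v, w} L k A B := by
  obtain ⟨F, G, ⟨f₀, hf₀⟩, ⟨g₀, hg₀⟩, hF, -, hFG, hGF⟩ := h
  have hFG' : ∀ f ∈ F, ∀ l, ∃ g ∈ G, coextList g (coextList f l) = l := fun f hf l => by
    rcases eq_or_ne l [] with rfl | hl
    · exact ⟨g₀, hg₀, rfl⟩
    · exact (hFG f hf ⟨l, hl⟩).imp fun g hg => ⟨hg.1, congrArg Play.moves hg.2⟩
  have hGF' : ∀ g ∈ G, ∀ m, ∃ f ∈ F, coextList f (coextList g m) = m := fun g hg m => by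
    rcases eq_or_ne m [] with rfl | hm
    · exact ⟨f₀, hf₀, rfl⟩
    · exact (hGF g hg ⟨m, hm⟩).imp fun f hf => ⟨hf.1, congrArg Play.moves hf.2⟩
  refine fun φ _ hφ => realize_iff_of_backAndForth
    (H := fun e e' => ∃ f ∈ F, ∃ l, e = position l ∧ e' = position (coextList f l))
    ?_ ?_ ?_ ?_ ?_ φ hφ _ _ ⟨f₀, hf₀, [], rfl, rfl⟩
  · rintro _ _ ⟨f, -, l, rfl, rfl⟩
    exact sameDom_coextList f l
  · rintro _ _ ⟨f, hf, l, rfl, rfl⟩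
    exact (mem_strategies_iff.1 (hF hf) l).2
  · rintro _ _ ⟨f, hf, l, rfl, rfl⟩
    exact (mem_strategies_iff.1 (hF hf) l).1
  · rintro _ _ ⟨f, hf, l, rfl, rfl⟩ p a
    exact ⟨f ⟨l ++ [(p, a)], by simp⟩, f, hf, l ++ [(p, a)], by simp, by simp⟩
  · rintro _ _ ⟨f, hf, l, rfl, rfl⟩ p b
    obtain ⟨g, hg, hgl⟩ := hFG' f hf l
    obtain ⟨f', hf', hfl⟩ := hGF' g hg (coextList f l ++ [(p, b)])
    exact ⟨g ⟨coextList f l ++ [(p, b)], by simp⟩, f', hf',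
      coextList g (coextList f l ++ [(p, b)]), by rw [coextList_concat, position_concat, hgl],
      by rw [hfl, position_concat]⟩

theorem Transfers.forth_countingFree {e : Fin k → Option A} {e' : Fin k → Option B}
    (h : Transfers (InfFormula.CountingFree (L := L) (k := k)) e e') (p : Fin k) (a : A) :
    ∃ b, Transfers (InfFormula.CountingFree (L := L) (k := k)) (update e p (some a))
      (update e' p (some b)) :=
  h.forth (fun _ h => h) (fun _ _ h => h) p a

/-- The strategies that lead to positions which satisfy the same formulas without counting
quantifiers. -/
def typeStrategies (L : FirstOrder.Language.{u, v}) (k : ℕ) (A B : Type w) [L.Structure A]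
    [L.Structure B] : Set (Play k A → B) :=
  {f | ∀ l, Transfers (InfFormula.CountingFree (L := L) (k := k))
    (position l) (position (coextList f l))}

theorem typeStrategies_subset [IsEmpty (L.Relations 0)] :
    typeStrategies L k A B ⊆ strategies L k A B := fun _ hf =>
  mem_strategies_iff.2 fun l =>
    ⟨⟨(hf l).preservesEq fun _ _ => trivial,
      ((hf l).symm fun _ h => h).preservesEq fun _ _ => trivial⟩,
    (hf l).preservesRel fun _ _ => trivial,
    ((hf l).symm fun _ h => h).preservesRel fun _ _ => trivial⟩

theorem typeStrategies_nonempty (h : VarEquiv.{u, v, w} L k A B) :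
    (typeStrategies L k A B).Nonempty :=
  exists_strategy (Good := fun l m => Transfers (InfFormula.CountingFree (L := L) (k := k))
    (position l) (position m)) (transfers_none fun φ h1 h2 => (h φ h1 h2).1) fun l m hlm p a => by
    simpa using hlm.forth_countingFree p a

theorem exists_typeStrategies_inverse (h : VarEquiv.{u, v, w} L k B A) {f : Play k A → B}
    (hf : f ∈ typeStrategies L k A B) (s : Play k A) :
    ∃ g ∈ typeStrategies L k B A, coext g (coext f s) = s := by
  obtain ⟨g, hg, hgs⟩ := exists_strategy_inverting
    (R := Transfers (InfFormula.CountingFree (L := L) (k := k)))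
    (transfers_none fun φ h1 h2 => (h φ h1 h2).1) (fun e e' h => h.forth_countingFree)
    (fun l => (hf l).symm fun _ h => h) s.moves
  exact ⟨g, hg, Play.ext hgs⟩

theorem varEquiv_iff [IsEmpty (L.Relations 0)] : VarEquiv.{u, v, w} L k A B ↔ BackAndForth L k A B := by
  refine ⟨fun h => ?_, varEquiv_of_backAndForth⟩
  have h' : VarEquiv.{u, v, w} L k B A := fun φ h1 h2 => (h φ h1 h2).symm
  exact ⟨typeStrategies L k A B, typeStrategies L k B A, typeStrategies_nonempty h,
    typeStrategies_nonempty h', typeStrategies_subset, typeStrategies_subset,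
    fun f hf => exists_typeStrategies_inverse h' hf,
    fun g hg => exists_typeStrategies_inverse h hg⟩

end BackAndForth

/-! ### Logic with counting quantifiers -/

section Counting

open FirstOrder.Language.Structure Function

variable {k : ℕ} {A B C : Type w} {L : FirstOrder.Language.{u, v}}
  [L.Structure A] [L.Structure B] [L.Structure C]

theorem klInverse_iff [L.IsRelational] {f : Play k A →[L] B} {g : Play k B →[L] A} :
    KlInverse f g ↔
      (∀ l, coextList g (coextList f l) = l) ∧ ∀ m, coextList f (coextList g m) = m := by
  have key : ∀ {A B : Type w} [L.Structure A] [L.Structure B] (f : Play k A →[L] B)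
      (g : Play k B →[L] A),
      klComp g f = counit L k A ↔ ∀ l, coextList g (coextList f l) = l := by
    intro A B _ _ f g
    rw [← coext_coext_eq_self_iff]
    constructor
    · intro h s
      have h' : (fun s => g (coext f s)) = Play.eps := funext fun s => DFunLike.congr_fun h s
      rw [← coext_coext, h', coext_eps]
    · intro h
      ext s
      change g (coext f s) = s.eps
      rw [← eps_coext g, h]
  exact and_congr (key f g) (key g f)

/-- The bijections that answer the moves, used forwards and backwards, give two mutually inverse
strategies. -/
theorem klIIso_of_countingEquiv [L.IsRelational] [IsEmpty (L.Relations 0)] [Finite A] [Finite B]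
    (hk : 0 < k) (h : CountingEquiv.{u, v, w} L k A B) : KlIIso L k A B := by
  have hneg : ∀ φ : InfFormula.{u, v, w} L k, True → True := fun _ _ => trivial
  obtain ⟨f, g, hf, hgf, hfg⟩ := exists_inverse_strategies (A := A) (B := B) hk
    (Good := fun l m => Transfers (fun _ : InfFormula.{u, v, w} L k => True)
      (position l) (position m))
    (transfers_none fun φ h1 _ => (h φ h1).1) fun l m hlm p => by
      simpa using hlm.exists_equiv p
  have hg : ∀ m, Transfers (fun _ : InfFormula.{u, v, w} L k => True)
      (position m) (position (coextList g m)) := fun m => by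
    have := hf (coextList g m)
    rw [hfg] at this
    exact this.symm hneg
  -- equality of pebbled elements is expressible, so the strategies are `I`-morphisms
  have hI : ∀ {A B : Type w} [L.Structure A] [L.Structure B] (f : Play k A → B),
      (∀ l, Transfers (fun _ : InfFormula.{u, v, w} L k => True)
        (position l) (position (coextList f l))) →
      ∀ s t : Play k A, s.moves <+: t.moves → s.ActiveIn t → s.eps = t.eps → f s = f t := by
    rintro A B _ _ f hf s t ⟨r, hr⟩ hst heps
    have ht : t.moves = t.moves ++ [] := (List.append_nil _).symm
    have h1 := (hf t.moves).preservesEq (fun _ _ => trivial) s.last.1 t.last.1 t.eps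
      (by rw [← heps]; exact position_of_active hr.symm (hst r hr.symm))
      (position_of_active ht (by simp))
    rw [position_coextList_of_active hr.symm (hst r hr.symm),
      position_coextList_of_active ht (by simp)] at h1
    exact Option.some_injective _ h1
  exact ⟨⟨f, fun g => isEmptyElim g, fun R s hs => preservesRel_imp_relMap
      (fun l => (hf l).preservesRel fun _ _ => trivial) R s hs⟩,
    ⟨g, fun g => isEmptyElim g, fun R s hs => preservesRel_imp_relMap
      (fun l => (hg l).preservesRel fun _ _ => trivial) R s hs⟩,
    hI f hf, hI g hg, klInverse_iff.2 ⟨hgf, hfg⟩⟩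

theorem PreservesRel.trans {e : Fin k → Option A} {e' : Fin k → Option B} {e'' : Fin k → Option C}
    (h : PreservesRel L e e') (hd : SameDom e e') (h' : PreservesRel L e' e'') :
    PreservesRel L e e'' := by
  intro n R x a c ha hc hR
  obtain ⟨b, hb⟩ := hd.exists_of_forall ha
  exact h' n R x b c hb hc (h n R x a b ha hb hR)

theorem SameDom.trans {e : Fin k → Option A} {e' : Fin k → Option B} {e'' : Fin k → Option C}
    (h : SameDom e e') (h' : SameDom e' e'') : SameDom e e'' := fun p => (h p).trans (h' p)

variable (L) in
/-- Equivalence of positions in the bijective game that does not look at equality: the largest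
bijective system. -/
def BijectivelyEquiv (e : Fin k → Option A) (e' : Fin k → Option B) : Prop :=
  ∃ H, IsBijectiveSystem L H ∧ H e e'

theorem isBijectiveSystem_bijectivelyEquiv :
    IsBijectiveSystem L (BijectivelyEquiv L : (Fin k → Option A) → (Fin k → Option B) → Prop) where
  dom := fun e e' ⟨_, hH, h⟩ => hH.dom e e' h
  rel := fun e e' ⟨_, hH, h⟩ => hH.rel e e' h
  rel_symm := fun e e' ⟨_, hH, h⟩ => hH.rel_symm e e' h
  bij := fun e e' ⟨H, hH, h⟩ p =>
    (hH.bij e e' h p).imp fun _ hβ a => ⟨H, hH, hβ a⟩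

theorem IsBijectiveSystem.symm {H : (Fin k → Option A) → (Fin k → Option B) → Prop}
    (hH : IsBijectiveSystem L H) : IsBijectiveSystem L fun e' e => H e e' where
  dom e' e h := (hH.dom e e' h).symm
  rel e' e h := hH.rel_symm e e' h
  rel_symm e' e h := hH.rel e e' h
  bij e' e h p := by
    obtain ⟨β, hβ⟩ := hH.bij e e' h p
    exact ⟨β.symm, fun b => by simpa using hβ (β.symm b)⟩

theorem BijectivelyEquiv.symm {e : Fin k → Option A} {e' : Fin k → Option B}
    (h : BijectivelyEquiv L e e') : BijectivelyEquiv L e' e := by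
  obtain ⟨H, hH, h⟩ := h
  exact ⟨_, hH.symm, h⟩

theorem BijectivelyEquiv.trans {e : Fin k → Option A} {e' : Fin k → Option B}
    {e'' : Fin k → Option C} (h : BijectivelyEquiv L e e') (h' : BijectivelyEquiv L e' e'') :
    BijectivelyEquiv L e e'' := by
  obtain ⟨H, hH, h⟩ := h
  obtain ⟨H', hH', h'⟩ := h'
  refine ⟨fun e e'' => ∃ e', H e e' ∧ H' e' e'', ⟨?_, ?_, ?_, ?_⟩, e', h, h'⟩
  · rintro e e'' ⟨e', h, h'⟩
    exact (hH.dom _ _ h).trans (hH'.dom _ _ h')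
  · rintro e e'' ⟨e', h, h'⟩
    exact (hH.rel _ _ h).trans (hH.dom _ _ h) (hH'.rel _ _ h')
  · rintro e e'' ⟨e', h, h'⟩
    exact (hH'.rel_symm _ _ h').trans (hH'.dom _ _ h').symm (hH.rel_symm _ _ h)
  · rintro e e'' ⟨e', h, h'⟩ p
    obtain ⟨β, hβ⟩ := hH.bij _ _ h p
    obtain ⟨γ, hγ⟩ := hH'.bij _ _ h' p
    exact ⟨β.trans γ, fun a => ⟨_, hβ a, hγ _⟩⟩

/-- Renaming pebbles, possibly identifying some, preserves equivalence: when a pebble moves, there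
is a pebble that the renaming of the other pebbles does not use. -/
theorem BijectivelyEquiv.comp {e : Fin k → Option A} {e' : Fin k → Option B}
    (h : BijectivelyEquiv L e e') (ρ : Fin k → Fin k) : BijectivelyEquiv L (e ∘ ρ) (e' ∘ ρ) := by
  obtain ⟨H, hH, h⟩ := h
  refine ⟨fun d d' => ∃ e e' ρ, H e e' ∧ d = e ∘ ρ ∧ d' = e' ∘ ρ, ⟨?_, ?_, ?_, ?_⟩,
    e, e', ρ, h, rfl, rfl⟩
  · rintro _ _ ⟨e, e', ρ, h, rfl, rfl⟩
    exact (hH.dom _ _ h).comp ρ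
  · rintro _ _ ⟨e, e', ρ, h, rfl, rfl⟩
    exact (hH.rel _ _ h).comp ρ
  · rintro _ _ ⟨e, e', ρ, h, rfl, rfl⟩
    exact (hH.rel_symm _ _ h).comp ρ
  · rintro _ _ ⟨e, e', ρ, h, rfl, rfl⟩ p
    obtain ⟨r, hr⟩ := exists_forall_ne_apply ρ p
    obtain ⟨β, hβ⟩ := hH.bij _ _ h r
    exact ⟨β, fun a => ⟨_, _, update ρ p r, hβ a, (update_comp_update _ hr _).symm,
      (update_comp_update _ hr _).symm⟩⟩

/-- A bijection inside a difunctional relation can be changed so as to extend a given finite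
partial bijection inside the relation. To make it send `a` to `b`, the values at `a` and at the
preimage of `b` are exchanged. -/
theorem exists_equiv_extending {X Y ι : Type*} [Finite ι] {M : X → Y → Prop}
    (hM : ∀ a b a' b', M a b → M a' b → M a' b' → M a b') (β : X ≃ Y) (hβ : ∀ a, M a (β a))
    (x : ι → X) (y : ι → Y) (hxy : ∀ i, M (x i) (y i)) (hinj : ∀ i j, x i = x j ↔ y i = y j) :
    ∃ γ : X ≃ Y, (∀ a, M a (γ a)) ∧ ∀ i, γ (x i) = y i := by
  classical
  have := Fintype.ofFinite ι
  suffices h : ∀ s : Finset ι, ∃ γ : X ≃ Y, (∀ a, M a (γ a)) ∧ ∀ i ∈ s, γ (x i) = y i by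
    obtain ⟨γ, h1, h2⟩ := h Finset.univ
    exact ⟨γ, h1, fun i => h2 i (Finset.mem_univ i)⟩
  intro s
  induction s using Finset.induction_on with
  | empty => exact ⟨β, hβ, by simp⟩
  | insert i s _ ih =>
    obtain ⟨γ, h1, h2⟩ := ih
    refine ⟨γ.trans (Equiv.swap (γ (x i)) (y i)), fun a => ?_, fun j hj => ?_⟩
    · rw [Equiv.trans_apply]
      rcases eq_or_ne a (x i) with rfl | hai
      · rw [Equiv.swap_apply_left]
        exact hxy i
      rcases eq_or_ne (γ a) (y i) with hay | hay
      · rw [hay, Equiv.swap_apply_right]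
        exact hM a (y i) (x i) _ (hay ▸ h1 a) (hxy i) (h1 _)
      · rw [Equiv.swap_apply_of_ne_of_ne (γ.injective.ne hai) hay]
        exact h1 a
    · rw [Equiv.trans_apply]
      by_cases hji : x j = x i
      · rw [hji, Equiv.swap_apply_left, (hinj j i).1 hji]
      · have hjs : j ∈ s := (Finset.mem_insert.1 hj).resolve_left fun h => hji (h ▸ rfl)
        rw [Equiv.swap_apply_of_ne_of_ne (γ.injective.ne hji), h2 j hjs]
        rw [h2 j hjs]
        exact mt (hinj j i).2 hji

/-- Equivalent positions with the same equalities between pebbled elements satisfy the same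
formulas. By renaming pebbles, moving a pebble to an element pebbled by `q` leads to a position
equivalent to that where the answer is the other element pebbled by `q`. Hence the bijection that
answers the moves can be taken to extend the correspondence of the pebbled elements, and then
equalities are still preserved and reflected. -/
theorem BijectivelyEquiv.realize_iff {e : Fin k → Option A} {e' : Fin k → Option B}
    (h : BijectivelyEquiv L e e') (h₁ : PreservesEq e e') (h₂ : PreservesEq e' e)
    (φ : InfFormula.{u, v, w} L k) : φ.Realize e ↔ φ.Realize e' := by
  refine IsBijectiveSystem.realize_iff
    (H := fun e e' => BijectivelyEquiv L e e' ∧ PreservesEq e e' ∧ PreservesEq e' e)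
    ⟨fun e e' h => isBijectiveSystem_bijectivelyEquiv.dom _ _ h.1,
      fun e e' h => isBijectiveSystem_bijectivelyEquiv.rel _ _ h.1,
      fun e e' h => isBijectiveSystem_bijectivelyEquiv.rel_symm _ _ h.1, ?_⟩
    (fun e e' h => h.2) φ e e' ⟨h, h₁, h₂⟩
  clear h h₁ h₂
  rintro e e' ⟨h, h₁, h₂⟩ p
  have hdom := isBijectiveSystem_bijectivelyEquiv.dom _ _ h
  obtain ⟨β, hβ⟩ := isBijectiveSystem_bijectivelyEquiv.bij _ _ h p
  have hx : ∀ i : {q // e q ≠ none}, ∃ a, e i = some a := fun i =>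
    Option.ne_none_iff_exists'.1 i.2
  have hy : ∀ i : {q // e q ≠ none}, ∃ b, e' i = some b := fun i =>
    Option.ne_none_iff_exists'.1 (mt (hdom i).2 i.2)
  choose x hx using hx
  choose y hy using hy
  -- moving `p` onto the element pebbled by `i` amounts to the renaming `update id p i`
  obtain ⟨γ, hγ, hext⟩ := exists_equiv_extending
    (M := fun a b => BijectivelyEquiv L (update e p (some a)) (update e' p (some b)))
    (fun a b a' b' h1 h2 h3 => h1.trans (h2.symm.trans h3)) β hβ x y
    (fun i => by
      have := h.comp (update id p i)
      rwa [comp_update_of_eq (hx i), comp_update_of_eq (hy i)] at this)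
    (fun i j => ⟨fun hij => Option.some_injective _ <| by
        rw [← hy i, ← hy j]; exact h₁ i j (x i) (hx i) (hij ▸ hx j),
      fun hij => Option.some_injective _ <| by
        rw [← hx i, ← hx j]; exact h₂ i j (y i) (hy i) (hij ▸ hy j)⟩)
  refine ⟨γ, fun a => ⟨hγ a, h₁.update fun q _ hq => ?_, h₂.update fun q _ hq => ?_⟩⟩
  · obtain ⟨i, rfl⟩ : ∃ i : {q // e q ≠ none}, i.1 = q := ⟨⟨q, by simp [hq]⟩, rfl⟩
    rw [hy, ← hext, Option.some_injective _ (hq.symm.trans (hx i))]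
  · obtain ⟨i, rfl⟩ : ∃ i : {q // e q ≠ none}, i.1 = q :=
      ⟨⟨q, fun h' => by simp [(hdom q).1 h'] at hq⟩, rfl⟩
    have hi := Option.some_injective _ (hq.symm.trans (hy i))
    rw [← hext] at hi
    rw [γ.injective hi, hx]

/-- Mutually inverse homomorphisms on plays give a bijective system: its answers to the moves of a
pebble are the next values of the two homomorphisms. They may violate equality, which is what
`BijectivelyEquiv.realize_iff` makes up for. -/
theorem countingEquiv_of_klIso [L.IsRelational] (h : KlIso L k A B) :
    CountingEquiv.{u, v, w} L k A B := by
  obtain ⟨f, g, hfg⟩ := h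
  obtain ⟨hgf, hfg⟩ := klInverse_iff.1 hfg
  refine fun φ _ => BijectivelyEquiv.realize_iff (e := fun _ => none) (e' := fun _ => none)
    ⟨fun e e' => ∃ l, e = position l ∧ e' = position (coextList f l), ⟨?_, ?_, ?_, ?_⟩,
      [], rfl, rfl⟩ (fun _ _ _ _ _ => rfl) (fun _ _ _ _ _ => rfl) φ
  · rintro _ _ ⟨l, rfl, rfl⟩
    exact sameDom_coextList f l
  · rintro _ _ ⟨l, rfl, rfl⟩
    exact preservesRel_coextList f l
  · rintro _ _ ⟨l, rfl, rfl⟩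
    have := preservesRel_coextList g (coextList f l)
    rwa [hgf] at this
  · rintro _ _ ⟨l, rfl, rfl⟩ p
    refine ⟨⟨fun a => f ⟨l ++ [(p, a)], by simp⟩, fun b => g ⟨coextList f l ++ [(p, b)], by simp⟩,
      fun a => ?_, fun b => ?_⟩, fun a => ⟨l ++ [(p, a)], by simp, by simp⟩⟩
    · simpa [hgf] using hgf (l ++ [(p, a)])
    · simpa [hgf] using hfg (coextList f l ++ [(p, b)])

end Counting

end Pebbling

theorem mainTheorem2 (L : FirstOrder.Language.{u, v}) [L.IsRelational] [IsEmpty (L.Relations 0)]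
    (k : ℕ) (hk : 0 < k) :
    (∀ (A B : Type w) [L.Structure A] [L.Structure B],
      Pebbling.ExPosEquiv L k A B ↔ Pebbling.KlMorphismsBothWays L k A B) ∧
    (∀ (A B : Type w) [L.Structure A] [L.Structure B] [Finite A] [Finite B],
      Pebbling.VarEquiv L k A B ↔ Pebbling.BackAndForth L k A B) ∧
    (∀ (A B : Type w) [L.Structure A] [L.Structure B] [Finite A] [Finite B],
      (Pebbling.CountingEquiv L k A B ↔ Pebbling.KlIIso L k A B) ∧
      (Pebbling.CountingEquiv L k A B ↔ Pebbling.KlIso L k A B)) := by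
  refine ⟨fun A B _ _ => Pebbling.exPosEquiv_iff, fun A B _ _ _ _ => Pebbling.varEquiv_iff,
    fun A B _ _ _ _ => ?_⟩
  have h : Pebbling.KlIIso L k A B → Pebbling.KlIso L k A B :=
    fun ⟨f, g, _, _, hfg⟩ => ⟨f, g, hfg⟩
  exact ⟨⟨Pebbling.klIIso_of_countingEquiv hk,
      fun h' => Pebbling.countingEquiv_of_klIso (h h')⟩,
    fun h' => h (Pebbling.klIIso_of_countingEquiv hk h'), Pebbling.countingEquiv_of_klIso⟩
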